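/- A frequency is a strictly increasing sequence $\omega=(\omega_n)_{n\in\mathbb N}$ of non-negative real numbers with $\omega_n\to\infty$. For a frequency $\omega$ and a finite set $J\subset\mathbb N$, let $\mathcal H_\infty^J(\omega)$ be the complex Banach space of all $\omega$-Dirichlet polynomials $D(s)=\sum_{n\in J}a_n e^{-\omega_n s}$ ($s\in\mathbb C$, $a_n\in\mathbb C$), normed by $\|D\|_\infty=\sup_{t\in\mathbb R}|D(it)|$. For a closed subspace $X$ of a complex Banach space $Y$ put $$\boldsymbol\lambda(X,Y)=\inf\{\|P\| : P\colon Y\to X \text{ bounded linear},\ P|_X=\mathrm{id}_X\}\qquad(\inf\emptyset=\infty),$$ and for a complex Banach space $X$ let its projection constant be $\boldsymbol\lambda(X)=\sup\boldsymbol\lambda(I(X),Y)$, the supremum being taken over all complex Banach spaces $Y$ and all linear isometric embeddings $I\colon X\to Y$ such that $I(X)$ is complemented in $Y$. **Theorem 2.1.** Let $J\subset\mathbb N$ be a finite set and $\omega=(\omega_n)$ a frequency. Then $\boldsymbol\lambda\big(\mathcal H_\infty^J(\omega)\big)$ is finite, the limit below exists, and $$\boldsymbol\lambda\big(\mathcal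 H_\infty^J(\omega)\big)=\lim_{T\to\infty}\frac1{2T}\int_{-T}^{T}\Big|\sum_{n\in J}e^{-i\omega_n t}\Big|\,dt .$$ -/

import Mathlib

open Filter Topology
open scoped ENNReal BoundedContinuousFunction

universe u v

namespace DirichletProj

/-! ### Projection constants -/

section ProjectionConstant

/-- The relative projection constant of a subspace `X` of a complex Banach space `Y`: the infimum
of the norms of all bounded linear projections of `Y` onto `X`, with `inf ∅ = ∞`. -/
noncomputable def relProjConst {Y : Type v} [NormedAddCommGroup Y] [NormedSpace ℂ Y]
    (X : Submodule ℂ Y) : ℝ≥0∞ :=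
  ⨅ (P : Y →L[ℂ] X) (_ : ∀ x : X, P (x : Y) = x), ENNReal.ofReal ‖P‖

/-- The (absolute) projection constant of a complex normed space `X`: the supremum of the relative
projection constants of `I(X)` in `Y`, over all complex Banach spaces `Y` and all linear isometric
embeddings `I : X → Y` whose range is complemented in `Y`. The Banach spaces `Y` range over a
universe `v`, which is arbitrary in the theorem. -/
noncomputable def projConst (X : Type u) [NormedAddCommGroup X] [NormedSpace ℂ X] : ℝ≥0∞ :=
  ⨆ (Y : Type v) (_ : NormedAddCommGroup Y) (_ : NormedSpace ℂ Y) (_ : CompleteSpace Y)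
    (I : X →ₗᵢ[ℂ] Y) (_ : (LinearMap.range I.toLinearMap).ClosedComplemented),
    relProjConst (LinearMap.range I.toLinearMap)

end ProjectionConstant

/-! ### Frequencies and Dirichlet polynomials -/

/-- A frequency: a strictly increasing, non-negative real sequence tending to infinity. -/
structure IsFrequency (ω : ℕ → ℝ) : Prop where
  strictMono : StrictMono ω
  nonneg : ∀ n, 0 ≤ ω n
  tendsto_atTop : Tendsto ω atTop atTop

/-- The vector space of all functions `s ↦ ∑ n ∈ J, a n * exp (-ω n * s)` on `ℂ`. -/
def dirichletPolynomials (ω : ℕ → ℝ) (J : Finset ℕ) : Submodule ℂ (ℂ → ℂ) where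
  carrier := {D | ∃ a : ℕ → ℂ, D = fun s => ∑ n ∈ J, a n * Complex.exp (-(ω n : ℂ) * s)}
  zero_mem' := ⟨0, by ext s; simp⟩
  add_mem' := by
    rintro _ _ ⟨a, rfl⟩ ⟨b, rfl⟩
    exact ⟨a + b, by ext s; simp [add_mul, Finset.sum_add_distrib]⟩
  smul_mem' := by
    rintro c _ ⟨a, rfl⟩
    exact ⟨c • a, by ext s; simp [Finset.mul_sum, mul_assoc]⟩

/-- The space of all `ω`-Dirichlet polynomials supported on `J`, to be normed by the supremum on
the imaginary line. It is a type synonym, so that it does not carry the topology of pointwise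
convergence. -/
def HInfty (ω : ℕ → ℝ) (J : Finset ℕ) : Type := dirichletPolynomials ω J

namespace HInfty

variable {ω : ℕ → ℝ} {J : Finset ℕ}

noncomputable instance : AddCommGroup (HInfty ω J) :=
  inferInstanceAs (AddCommGroup (dirichletPolynomials ω J))

noncomputable instance : Module ℂ (HInfty ω J) :=
  inferInstanceAs (Module ℂ (dirichletPolynomials ω J))

/-- The underlying entire function of a Dirichlet polynomial. -/
def toFun (D : HInfty ω J) : ℂ → ℂ := D.1

theorem exists_coeff (D : HInfty ω J) :
    ∃ a : ℕ → ℂ, D.toFun = fun s => ∑ n ∈ J, a n * Complex.exp (-(ω n : ℂ) * s) := D.2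

theorem differentiable_toFun (D : HInfty ω J) : Differentiable ℂ D.toFun := by
  obtain ⟨a, ha⟩ := D.exists_coeff
  rw [ha]
  fun_prop

theorem exists_bound (D : HInfty ω J) : ∃ C, ∀ t : ℝ, ‖D.toFun (Complex.I * t)‖ ≤ C := by
  obtain ⟨a, ha⟩ := D.exists_coeff
  refine ⟨∑ n ∈ J, ‖a n‖, fun t => ?_⟩
  rw [ha]
  refine (norm_sum_le _ _).trans (Finset.sum_le_sum fun n _ => ?_)
  simp [Complex.norm_exp]

/-- Restriction `t ↦ D (i t)` of a Dirichlet polynomial to the imaginary line, as a bounded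
continuous function. -/
noncomputable def restrict : HInfty ω J →ₗ[ℂ] (ℝ →ᵇ ℂ) where
  toFun D := BoundedContinuousFunction.ofNormedAddCommGroup
    (fun t : ℝ => D.toFun (Complex.I * t))
    (D.differentiable_toFun.continuous.comp (by fun_prop))
    D.exists_bound.choose D.exists_bound.choose_spec
  map_add' _ _ := rfl
  map_smul' _ _ := rfl

theorem restrict_apply (D : HInfty ω J) (t : ℝ) : restrict D t = D.toFun (Complex.I * t) := rfl

theorem restrict_injective : Function.Injective (restrict : HInfty ω J →ₗ[ℂ] (ℝ →ᵇ ℂ)) := by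
  intro D E h
  have hline : ∀ t : ℝ, D.toFun (Complex.I * t) = E.toFun (Complex.I * t) := fun t => by
    rw [← restrict_apply, h, restrict_apply]
  have hD : AnalyticOnNhd ℂ D.toFun Set.univ :=
    D.differentiable_toFun.differentiableOn.analyticOnNhd isOpen_univ
  have hE : AnalyticOnNhd ℂ E.toFun Set.univ :=
    E.differentiable_toFun.differentiableOn.analyticOnNhd isOpen_univ
  refine Subtype.ext (hD.eq_of_frequently_eq hE (z₀ := 0) ?_)
  have hlim : Tendsto (fun t : ℝ => Complex.I * (t : ℂ)) (𝓝[≠] 0) (𝓝[≠] 0) := by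
    refine tendsto_nhdsWithin_iff.2 ⟨?_, ?_⟩
    · refine Tendsto.mono_left ?_ nhdsWithin_le_nhds
      have : Continuous fun t : ℝ => Complex.I * (t : ℂ) := by fun_prop
      simpa using this.tendsto 0
    · filter_upwards [self_mem_nhdsWithin] with t ht
      simpa using ht
  exact hlim.frequently (Eventually.of_forall hline).frequently

/-- The norm `‖D‖ = sup_{t ∈ ℝ} |D (i t)|`; see `norm_eq`. -/
noncomputable instance : NormedAddCommGroup (HInfty ω J) :=
  NormedAddCommGroup.induced (HInfty ω J) (ℝ →ᵇ ℂ) restrict restrict_injective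

noncomputable instance : NormedSpace ℂ (HInfty ω J) :=
  NormedSpace.induced ℂ (HInfty ω J) (ℝ →ᵇ ℂ) restrict

theorem norm_eq (D : HInfty ω J) : ‖D‖ = ⨆ t : ℝ, ‖D.toFun (Complex.I * t)‖ :=
  BoundedContinuousFunction.norm_eq_iSup_norm (restrict D)

end HInfty

end DirichletProj

/-!
The space of Dirichlet polynomials sits isometrically in the bounded continuous functions on `ℝ`, by
restriction to the imaginary line; let `K = ∑ n ∈ J, exp (-i ω n t)` be the kernel there. Convolution
with `K`, with respect to the mean value of almost periodic functions, is the orthogonal projection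
onto the Dirichlet polynomials, and its norm is the mean value of `|K|`, which is the projection
constant.

Mean values are handled through `IsAveraging` nets of functionals. All such nets have the same limit
at uniform limits of trigonometric polynomials (`IsAveraging.tendsto_meanValue`). By Weierstrass
approximation, continuous functions of `|K|` are such uniform limits
(`mem_closure_of_eq_comp_norm`), so the limit of the theorem exists. It can be computed with the
integral averages `intervalMean` or with the discrete ones `sampleMean`.

For the upper bound (`HInfty.exists_leftInverse_norm_le`), the point evaluations at the points of
the imaginary line are extended, by Hahn-Banach, from an isometric copy of the space to the ambient
Banach space `Y`. Convolving `K` with these extensions gives a projection. The integral is replaced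
by discrete averages and a limit along an ultrafilter, since the extensions need not depend
measurably on the point.

For the lower bound (`HInfty.meanModulus_le_of_projection`), `Y` is the space of bounded continuous
functions itself. Averaging the conjugates of a projection `Q` by translations yields convolution
with `K`. So the mean of `f * star K` is at most `‖Q‖ * ‖f‖`, and taking for `f` regularizations of
the sign of `K` gives the mean value of `|K|`.
-/

namespace DirichletProj

/-! ### Trigonometric polynomials on the real line -/

/-- The character `t ↦ exp (i μ t)` of the real line, as a bounded continuous function. -/
noncomputable def expChar (μ : ℝ) : ℝ →ᵇ ℂ :=
  BoundedContinuousFunction.ofNormedAddCommGroup (fun t : ℝ => Complex.exp (Complex.I * μ * t))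
    (by fun_prop) 1 fun t => by
      rw [mul_assoc, ← Complex.ofReal_mul, Complex.norm_exp_I_mul_ofReal]

theorem expChar_apply (μ t : ℝ) : expChar μ t = Complex.exp (Complex.I * μ * t) := rfl

theorem expChar_zero : expChar 0 = 1 := by
  ext t
  simp [expChar_apply]

theorem expChar_mul (μ ν : ℝ) : expChar μ * expChar ν = expChar (μ + ν) := by
  ext t
  rw [BoundedContinuousFunction.mul_apply]
  simp only [expChar_apply, ← Complex.exp_add]
  push_cast
  ring_nf

theorem star_expChar (μ : ℝ) : star (expChar μ) = expChar (-μ) := by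
  ext t
  rw [BoundedContinuousFunction.star_apply]
  simp [expChar_apply, ← Complex.exp_conj]

theorem norm_expChar_apply (μ t : ℝ) : ‖expChar μ t‖ = 1 := by
  rw [expChar_apply, mul_assoc, ← Complex.ofReal_mul, Complex.norm_exp_I_mul_ofReal]

theorem expChar_apply_add (μ s t : ℝ) : expChar μ (s + t) = expChar μ s * expChar μ t := by
  simp only [expChar_apply, ← Complex.exp_add]
  push_cast
  ring_nf

theorem expChar_apply_neg (μ t : ℝ) : expChar μ (-t) = expChar (-μ) t := by
  simp [expChar_apply]

/-- Trigonometric polynomials with arbitrary real frequencies. -/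
noncomputable def trigPoly : Submodule ℂ (ℝ →ᵇ ℂ) := Submodule.span ℂ (Set.range expChar)

theorem expChar_mem_trigPoly (μ : ℝ) : expChar μ ∈ trigPoly :=
  Submodule.subset_span ⟨μ, rfl⟩

theorem one_mem_trigPoly : (1 : ℝ →ᵇ ℂ) ∈ trigPoly :=
  expChar_zero ▸ expChar_mem_trigPoly 0

theorem mul_mem_trigPoly {f g : ℝ →ᵇ ℂ} (hf : f ∈ trigPoly) (hg : g ∈ trigPoly) :
    f * g ∈ trigPoly := by
  have h := Submodule.mul_mem_mul hf hg
  rw [trigPoly, Submodule.span_mul_span] at h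
  refine Submodule.span_mono ?_ h
  rintro _ ⟨_, ⟨μ, rfl⟩, _, ⟨ν, rfl⟩, rfl⟩
  exact ⟨μ + ν, (expChar_mul μ ν).symm⟩

theorem star_mem_trigPoly {f : ℝ →ᵇ ℂ} (hf : f ∈ trigPoly) : star f ∈ trigPoly := by
  refine Submodule.span_induction ?_ ?_ ?_ ?_ hf
  · rintro _ ⟨μ, rfl⟩
    exact star_expChar μ ▸ expChar_mem_trigPoly (-μ)
  · rw [star_zero]
    exact zero_mem _
  · intro f g _ _ hf hg
    rw [star_add]
    exact add_mem hf hg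
  · intro c f _ hf
    rw [star_smul]
    exact Submodule.smul_mem _ _ hf

theorem pow_mem_trigPoly {f : ℝ →ᵇ ℂ} (hf : f ∈ trigPoly) (n : ℕ) : f ^ n ∈ trigPoly := by
  induction n with
  | zero => simpa using one_mem_trigPoly
  | succ n ih =>
    rw [pow_succ]
    exact mul_mem_trigPoly ih hf

theorem mul_mem_closure_trigPoly {f g : ℝ →ᵇ ℂ} (hf : f ∈ trigPoly)
    (hg : g ∈ trigPoly.topologicalClosure) : f * g ∈ trigPoly.topologicalClosure := by
  have hcont : Continuous fun g : ℝ →ᵇ ℂ => f * g := continuous_const.mul continuous_id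
  rw [← SetLike.mem_coe, Submodule.topologicalClosure_coe] at hg ⊢
  exact map_mem_closure hcont hg fun h hh => mul_mem_trigPoly hf hh

/-- A continuous function of the modulus of a trigonometric polynomial is a uniform limit of
trigonometric polynomials: by Weierstrass, it is a uniform limit of polynomials in `‖K‖ ^ 2`. -/
theorem mem_closure_of_eq_comp_norm {K F : ℝ →ᵇ ℂ} (hK : K ∈ trigPoly) {g : ℝ → ℝ}
    (hg : Continuous g) (hF : ∀ t, F t = g ‖K t‖) : F ∈ trigPoly.topologicalClosure := by
  rw [← SetLike.mem_coe, Submodule.topologicalClosure_coe, Metric.mem_closure_iff]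
  intro ε hε
  obtain ⟨p, hp⟩ := exists_polynomial_near_of_continuousOn 0 (‖K‖ ^ 2) (fun x => g (Real.sqrt x))
    (hg.comp Real.continuous_sqrt).continuousOn (ε / 2) (by positivity)
  set N : ℝ →ᵇ ℂ := K * star K with hN
  have hNmem : N ∈ trigPoly := mul_mem_trigPoly hK (star_mem_trigPoly hK)
  have hNapp : ∀ t, N t = ((‖K t‖ ^ 2 : ℝ) : ℂ) := fun t => by
    rw [hN, BoundedContinuousFunction.mul_apply, BoundedContinuousFunction.star_apply]
    simpa using Complex.mul_conj' (K t)
  refine ⟨∑ i ∈ Finset.range (p.natDegree + 1), (p.coeff i : ℂ) • N ^ i,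
    Submodule.sum_mem _ fun i _ => Submodule.smul_mem _ _ (pow_mem_trigPoly hNmem i), ?_⟩
  have hlt : ε / 2 < ε := by linarith
  refine lt_of_le_of_lt ?_ hlt
  refine (BoundedContinuousFunction.dist_le (by positivity)).2 fun t => ?_
  have hval : (∑ i ∈ Finset.range (p.natDegree + 1), (p.coeff i : ℂ) • N ^ i) t
      = ((p.eval (‖K t‖ ^ 2) : ℝ) : ℂ) := by
    rw [Polynomial.eval_eq_sum_range, BoundedContinuousFunction.coe_sum, Finset.sum_apply]
    push_cast
    refine Finset.sum_congr rfl fun i _ => ?_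
    rw [BoundedContinuousFunction.smul_apply, BoundedContinuousFunction.pow_apply, hNapp]
    simp
  rw [hval, hF, Complex.dist_eq, ← Complex.ofReal_sub, Complex.norm_real, Real.norm_eq_abs,
    abs_sub_comm]
  have h := hp (‖K t‖ ^ 2) ⟨by positivity, by gcongr; exact K.norm_coe_le_norm t⟩
  rw [Real.sqrt_sq (norm_nonneg _)] at h
  exact h.le

/-! ### Mean values -/

/-- A net of contractive linear functionals on the bounded continuous functions which, in the
limit, annihilates every character but the trivial one. -/
structure IsAveraging {ι : Type*} (l : Filter ι) (M : ι → (ℝ →ᵇ ℂ) →ₗ[ℂ] ℂ) : Prop where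
  norm_le : ∀ i f, ‖M i f‖ ≤ ‖f‖
  tendsto_expChar : ∀ μ, Tendsto (fun i => M i (expChar μ)) l (𝓝 (if μ = 0 then 1 else 0))

namespace IsAveraging

variable {ι κ : Type*} {l : Filter ι} {l' : Filter κ} {M : ι → (ℝ →ᵇ ℂ) →ₗ[ℂ] ℂ}
  {M' : κ → (ℝ →ᵇ ℂ) →ₗ[ℂ] ℂ}

theorem exists_tendsto_of_mem_trigPoly (hM : IsAveraging l M) (hM' : IsAveraging l' M')
    {f : ℝ →ᵇ ℂ} (hf : f ∈ trigPoly) :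
    ∃ c, Tendsto (fun i => M i f) l (𝓝 c) ∧ Tendsto (fun i => M' i f) l' (𝓝 c) := by
  refine Submodule.span_induction ?_ ?_ ?_ ?_ hf
  · rintro _ ⟨μ, rfl⟩
    exact ⟨_, hM.tendsto_expChar μ, hM'.tendsto_expChar μ⟩
  · exact ⟨0, by simpa using tendsto_const_nhds, by simpa using tendsto_const_nhds⟩
  · rintro f g _ _ ⟨c, h, h'⟩ ⟨d, k, k'⟩
    exact ⟨c + d, by simpa using h.add k, by simpa using h'.add k'⟩
  · rintro a f _ ⟨c, h, h'⟩
    exact ⟨a * c, by simpa using h.const_mul a, by simpa using h'.const_mul a⟩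

theorem tendstoUniformlyOnFilter (hM : IsAveraging l M) {F : ℕ → ℝ →ᵇ ℂ} {f : ℝ →ᵇ ℂ}
    (hF : Tendsto F atTop (𝓝 f)) :
    TendstoUniformlyOnFilter (fun k i => M i (F k)) (fun i => M i f) atTop l := by
  rw [Metric.tendstoUniformlyOnFilter_iff]
  intro ε hε
  refine ((Metric.tendsto_nhds.1 hF ε hε).prod_inl l).mono fun x hx => lt_of_le_of_lt ?_ hx
  rw [dist_eq_norm, ← map_sub, dist_eq_norm, norm_sub_rev (F x.1)]
  exact hM.norm_le _ _

/-- Two averaging nets converge to the same value at every almost periodic function. -/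
theorem exists_tendsto [l.NeBot] (hM : IsAveraging l M) (hM' : IsAveraging l' M')
    {f : ℝ →ᵇ ℂ} (hf : f ∈ trigPoly.topologicalClosure) :
    ∃ c, Tendsto (fun i => M i f) l (𝓝 c) ∧ Tendsto (fun i => M' i f) l' (𝓝 c) := by
  rw [← SetLike.mem_coe, Submodule.topologicalClosure_coe, mem_closure_iff_seq_limit] at hf
  obtain ⟨F, hF, hlim⟩ := hf
  choose c hc hc' using fun k => hM.exists_tendsto_of_mem_trigPoly hM' (hF k)
  have hcauchy : CauchySeq c := by
    have hFc := hlim.cauchySeq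
    rw [Metric.cauchySeq_iff] at hFc ⊢
    intro ε hε
    obtain ⟨N, hN⟩ := hFc ε hε
    refine ⟨N, fun m hm n hn => lt_of_le_of_lt ?_ (hN m hm n hn)⟩
    rw [dist_eq_norm, dist_eq_norm]
    refine le_of_tendsto ((hc m).sub (hc n)).norm (Eventually.of_forall fun i => ?_)
    rw [← map_sub]
    exact hM.norm_le i _
  obtain ⟨d, hd⟩ := cauchySeq_tendsto_of_complete hcauchy
  exact ⟨d, (hM.tendstoUniformlyOnFilter hlim).tendsto_of_eventually_tendsto
      (Eventually.of_forall hc) hd,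
    (hM'.tendstoUniformlyOnFilter hlim).tendsto_of_eventually_tendsto
      (Eventually.of_forall hc') hd⟩

end IsAveraging

/-- The symmetric average `f ↦ (2T)⁻¹ ∫_{-T}^T f`. -/
noncomputable def intervalMean (T : ℝ) : (ℝ →ᵇ ℂ) →ₗ[ℂ] ℂ where
  toFun f := 1 / (2 * T : ℂ) * ∫ t in (-T)..T, f t
  map_add' f g := by
    rw [← mul_add, ← intervalIntegral.integral_add (f.continuous.intervalIntegrable _ _)
      (g.continuous.intervalIntegrable _ _)]
    rfl
  map_smul' c f := by
    simp only [BoundedContinuousFunction.smul_apply, smul_eq_mul,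
      intervalIntegral.integral_const_mul, RingHom.id_apply]
    ring

theorem intervalMean_apply (T : ℝ) (f : ℝ →ᵇ ℂ) :
    intervalMean T f = 1 / (2 * T : ℂ) * ∫ t in (-T)..T, f t := rfl

theorem norm_intervalMean_le (T : ℝ) (f : ℝ →ᵇ ℂ) : ‖intervalMean T f‖ ≤ ‖f‖ := by
  rw [intervalMean_apply, norm_mul]
  have h := intervalIntegral.norm_integral_le_of_norm_le_const (a := -T) (b := T)
    (f := f) (C := ‖f‖) fun t _ => f.norm_coe_le_norm t
  have hT : |T - -T| = 2 * |T| := by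
    rw [sub_neg_eq_add, ← two_mul, abs_mul, abs_two]
  have hn : ‖1 / (2 * T : ℂ)‖ = 1 / (2 * |T|) := by simp
  rw [hn]
  rcases eq_or_ne T 0 with rfl | h0
  · simp
  · have : 0 < |T| := abs_pos.2 h0
    rw [hT] at h
    calc 1 / (2 * |T|) * ‖∫ t in (-T)..T, f t‖ ≤ 1 / (2 * |T|) * (‖f‖ * (2 * |T|)) := by gcongr
      _ = ‖f‖ := by field_simp

theorem isAveraging_intervalMean : IsAveraging atTop intervalMean where
  norm_le := norm_intervalMean_le
  tendsto_expChar μ := by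
    split_ifs with hμ
    · subst hμ
      refine tendsto_const_nhds.congr' ?_
      filter_upwards [eventually_gt_atTop 0] with T hT
      have : (T : ℂ) ≠ 0 := by exact_mod_cast hT.ne'
      simp [intervalMean_apply, expChar_zero]
      field_simp
      norm_num
    · have hc : Complex.I * μ ≠ 0 := by simp [hμ]
      refine squeeze_zero_norm' (a := fun T : ℝ => |μ|⁻¹ * T⁻¹) ?_ ?_
      · filter_upwards [eventually_gt_atTop 0] with T hT
        rw [intervalMean_apply]
        simp only [expChar_apply]
        rw [integral_exp_mul_complex hc, ← expChar_apply, ← expChar_apply, norm_mul,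
          norm_div _ (Complex.I * μ)]
        have h2 : ‖expChar μ T - expChar μ (-T)‖ ≤ 2 := by
          refine (norm_sub_le _ _).trans ?_
          rw [norm_expChar_apply, norm_expChar_apply]
          norm_num
        have hn : ‖1 / (2 * T : ℂ)‖ = 1 / (2 * T) := by simp [abs_of_pos hT]
        have hn' : ‖Complex.I * μ‖ = |μ| := by simp
        rw [hn, hn']
        have : 0 < |μ| := abs_pos.2 hμ
        calc 1 / (2 * T) * (‖expChar μ T - expChar μ (-T)‖ / |μ|)
            ≤ 1 / (2 * T) * (2 / |μ|) := by gcongr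
          _ = |μ|⁻¹ * T⁻¹ := by field_simp
      · simpa using tendsto_inv_atTop_zero.const_mul |μ|⁻¹

/-- The discrete average over the points `s - j / n` with `j < n ^ 2`. Both the mesh `1 / n` and
the reciprocal `1 / n` of the length of the sampled interval tend to `0`. -/
noncomputable def sampleMean (s : ℝ) (n : ℕ) : (ℝ →ᵇ ℂ) →ₗ[ℂ] ℂ where
  toFun f := ((n : ℂ) ^ 2)⁻¹ * ∑ j ∈ Finset.range (n ^ 2), f (s - j / n)
  map_add' f g := by
    simp [Finset.sum_add_distrib, mul_add]
  map_smul' c f := by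
    simp only [BoundedContinuousFunction.smul_apply, smul_eq_mul, ← Finset.mul_sum,
      RingHom.id_apply]
    ring

theorem sampleMean_apply (s : ℝ) (n : ℕ) (f : ℝ →ᵇ ℂ) :
    sampleMean s n f = ((n : ℂ) ^ 2)⁻¹ * ∑ j ∈ Finset.range (n ^ 2), f (s - j / n) := rfl

theorem norm_sampleMean_le (s : ℝ) (n : ℕ) (f : ℝ →ᵇ ℂ) : ‖sampleMean s n f‖ ≤ ‖f‖ := by
  rw [sampleMean_apply, norm_mul]
  have h : ‖∑ j ∈ Finset.range (n ^ 2), f (s - j / n)‖ ≤ (n : ℝ) ^ 2 * ‖f‖ := by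
    refine (norm_sum_le_of_le _ fun j _ => f.norm_coe_le_norm _).trans ?_
    simp
  have hn : ‖((n : ℂ) ^ 2)⁻¹‖ = ((n : ℝ) ^ 2)⁻¹ := by simp
  rw [hn]
  rcases eq_or_ne n 0 with rfl | h0
  · simp
  · have : (0 : ℝ) < n := by positivity
    calc ((n : ℝ) ^ 2)⁻¹ * ‖∑ j ∈ Finset.range (n ^ 2), f (s - j / n)‖
        ≤ ((n : ℝ) ^ 2)⁻¹ * ((n : ℝ) ^ 2 * ‖f‖) := by gcongr
      _ = ‖f‖ := by field_simp

theorem isAveraging_sampleMean (s : ℝ) : IsAveraging atTop (sampleMean s) where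
  norm_le := norm_sampleMean_le s
  tendsto_expChar μ := by
    split_ifs with hμ
    · subst hμ
      refine tendsto_const_nhds.congr' ?_
      filter_upwards [eventually_gt_atTop 0] with n hn
      have : (n : ℂ) ≠ 0 := by exact_mod_cast hn.ne'
      simp [sampleMean_apply, expChar_zero]
      field_simp
    · have hpos : 0 < |μ| := abs_pos.2 hμ
      refine squeeze_zero_norm' (a := fun n : ℕ => Real.pi / |μ| * (n : ℝ)⁻¹) ?_ ?_
      · filter_upwards [eventually_gt_atTop 0,
          tendsto_natCast_atTop_atTop.eventually_ge_atTop (|μ| / Real.pi)] with n hn hle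
        have hn' : (0 : ℝ) < n := by exact_mod_cast hn
        -- `x` is the angle between consecutive sample points; `|x| ≤ π` by the choice of `n`.
        set x : ℝ := -μ / n with hx
        have habs : |x| = |μ| / n := by rw [hx, abs_div, abs_neg, abs_of_pos hn']
        have hxle : |x / 2| ≤ Real.pi / 2 := by
          rw [abs_div, abs_two, habs]
          gcongr
          rw [div_le_iff₀ hn']
          rwa [div_le_iff₀' Real.pi_pos] at hle
        have hlow : 2 / Real.pi * |x| ≤ ‖Complex.exp (Complex.I * x) - 1‖ := by
          rw [Complex.norm_exp_I_mul_ofReal_sub_one, Real.norm_eq_abs, abs_mul, abs_two]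
          have := Real.mul_abs_le_abs_sin hxle
          rw [abs_div, abs_two] at this
          linarith
        have hxpos : 0 < |x| := by rw [habs]; positivity
        have hlow' : 0 < ‖Complex.exp (Complex.I * x) - 1‖ :=
          lt_of_lt_of_le (by have := Real.pi_pos; positivity) hlow
        have hne : Complex.exp (Complex.I * x) ≠ 1 := sub_ne_zero.1 (norm_pos_iff.1 hlow')
        have hsum : ∑ j ∈ Finset.range (n ^ 2), expChar μ (s - j / n)
            = expChar μ s * ((Complex.exp (Complex.I * x) ^ (n ^ 2) - 1)
              / (Complex.exp (Complex.I * x) - 1)) := by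
          rw [← geom_sum_eq hne, Finset.mul_sum]
          refine Finset.sum_congr rfl fun j _ => ?_
          rw [sub_eq_add_neg, expChar_apply_add, ← Complex.exp_nat_mul, expChar_apply μ (-_), hx]
          push_cast
          ring_nf
        have hnum : ‖Complex.exp (Complex.I * x) ^ (n ^ 2) - 1‖ ≤ 2 := by
          refine (norm_sub_le _ _).trans ?_
          rw [norm_pow, Complex.norm_exp_I_mul_ofReal, one_pow, norm_one]
          norm_num
        rw [sampleMean_apply, hsum, norm_mul, norm_mul, norm_expChar_apply, one_mul, norm_div]
        have hni : ‖((n : ℂ) ^ 2)⁻¹‖ = ((n : ℝ) ^ 2)⁻¹ := by simp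
        rw [hni]
        have hpi := Real.pi_pos
        calc ((n : ℝ) ^ 2)⁻¹ * (‖Complex.exp (Complex.I * x) ^ (n ^ 2) - 1‖
              / ‖Complex.exp (Complex.I * x) - 1‖)
            ≤ ((n : ℝ) ^ 2)⁻¹ * (2 / (2 / Real.pi * |x|)) := by gcongr
          _ = Real.pi / |μ| * (n : ℝ)⁻¹ := by
            rw [habs]
            field_simp
      · simpa using tendsto_inv_atTop_nhds_zero_nat.const_mul (Real.pi / |μ|)

/-- The mean value `lim_{T → ∞} (2T)⁻¹ ∫_{-T}^T f`; the limit exists if `f` is a uniform limit of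
trigonometric polynomials, see `IsAveraging.tendsto_meanValue`. -/
noncomputable def meanValue (f : ℝ →ᵇ ℂ) : ℂ := limUnder atTop fun T => intervalMean T f

theorem IsAveraging.tendsto_meanValue {ι : Type*} {l : Filter ι} {M : ι → (ℝ →ᵇ ℂ) →ₗ[ℂ] ℂ}
    (hM : IsAveraging l M) {f : ℝ →ᵇ ℂ} (hf : f ∈ trigPoly.topologicalClosure) :
    Tendsto (fun i => M i f) l (𝓝 (meanValue f)) := by
  obtain ⟨c, h, h'⟩ := isAveraging_intervalMean.exists_tendsto hM hf
  rwa [meanValue, h.limUnder_eq]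

theorem mem_closure_of_mem_trigPoly {f : ℝ →ᵇ ℂ} (hf : f ∈ trigPoly) :
    f ∈ trigPoly.topologicalClosure := trigPoly.le_topologicalClosure hf

theorem meanValue_expChar (μ : ℝ) : meanValue (expChar μ) = if μ = 0 then 1 else 0 :=
  (isAveraging_intervalMean.tendsto_expChar μ).limUnder_eq

theorem meanValue_add {f g : ℝ →ᵇ ℂ} (hf : f ∈ trigPoly.topologicalClosure)
    (hg : g ∈ trigPoly.topologicalClosure) : meanValue (f + g) = meanValue f + meanValue g := by
  refine tendsto_nhds_unique (isAveraging_intervalMean.tendsto_meanValue (add_mem hf hg)) ?_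
  simpa only [map_add] using (isAveraging_intervalMean.tendsto_meanValue hf).add
    (isAveraging_intervalMean.tendsto_meanValue hg)

theorem meanValue_smul (c : ℂ) {f : ℝ →ᵇ ℂ} (hf : f ∈ trigPoly.topologicalClosure) :
    meanValue (c • f) = c * meanValue f := by
  refine tendsto_nhds_unique
    (isAveraging_intervalMean.tendsto_meanValue (Submodule.smul_mem _ c hf)) ?_
  simpa only [map_smul, smul_eq_mul] using
    (isAveraging_intervalMean.tendsto_meanValue hf).const_mul c

theorem meanValue_zero : meanValue 0 = 0 := by
  simpa using meanValue_smul 0 (zero_mem trigPoly.topologicalClosure)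

theorem meanValue_sub {f g : ℝ →ᵇ ℂ} (hf : f ∈ trigPoly.topologicalClosure)
    (hg : g ∈ trigPoly.topologicalClosure) : meanValue (f - g) = meanValue f - meanValue g := by
  have h := meanValue_add (sub_mem hf hg) hg
  rw [sub_add_cancel] at h
  rw [h, add_sub_cancel_right]

theorem meanValue_sum {ι : Type*} (s : Finset ι) {f : ι → ℝ →ᵇ ℂ}
    (hf : ∀ i ∈ s, f i ∈ trigPoly.topologicalClosure) :
    meanValue (∑ i ∈ s, f i) = ∑ i ∈ s, meanValue (f i) := by
  classical
  induction s using Finset.induction_on with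
  | empty => simpa using meanValue_zero
  | insert a s ha ih =>
    rw [Finset.sum_insert ha, Finset.sum_insert ha, meanValue_add (hf a (by simp))
      (sum_mem fun i hi => hf i (by simp [hi])), ih fun i hi => hf i (by simp [hi])]

theorem norm_meanValue_le {f : ℝ →ᵇ ℂ} (hf : f ∈ trigPoly.topologicalClosure) :
    ‖meanValue f‖ ≤ ‖f‖ :=
  le_of_tendsto (isAveraging_intervalMean.tendsto_meanValue hf).norm
    (Eventually.of_forall fun T => norm_intervalMean_le T f)

/-! ### Translations -/

/-- The translate `t ↦ f (t + s)`. -/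
noncomputable def translate (s : ℝ) (f : ℝ →ᵇ ℂ) : ℝ →ᵇ ℂ :=
  f.compContinuous ⟨fun t => t + s, by fun_prop⟩

theorem translate_apply (s t : ℝ) (f : ℝ →ᵇ ℂ) : translate s f t = f (t + s) := rfl

theorem norm_translate_le (s : ℝ) (f : ℝ →ᵇ ℂ) : ‖translate s f‖ ≤ ‖f‖ :=
  (BoundedContinuousFunction.norm_le (norm_nonneg f)).2 fun t => f.norm_coe_le_norm (t + s)

theorem translate_expChar (s μ : ℝ) : translate s (expChar μ) = expChar μ s • expChar μ := by
  ext t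
  rw [translate_apply, expChar_apply_add, mul_comm]
  rfl

/-! ### The Dirichlet kernel -/

/-- The kernel `t ↦ ∑ n ∈ J, exp (-i ω n t)`. -/
noncomputable def dirichletKernel (ω : ℕ → ℝ) (J : Finset ℕ) : ℝ →ᵇ ℂ :=
  ∑ n ∈ J, expChar (-ω n)

/-- The modulus `t ↦ ‖f t‖`, viewed as a complex-valued function. -/
noncomputable def modulus (f : ℝ →ᵇ ℂ) : ℝ →ᵇ ℂ :=
  BoundedContinuousFunction.ofNormedAddCommGroup (fun t => ((‖f t‖ : ℝ) : ℂ)) (by fun_prop) ‖f‖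
    fun t => by simpa using f.norm_coe_le_norm t

theorem modulus_apply (f : ℝ →ᵇ ℂ) (t : ℝ) : modulus f t = ((‖f t‖ : ℝ) : ℂ) := rfl

theorem modulus_mem {f : ℝ →ᵇ ℂ} (hf : f ∈ trigPoly) : modulus f ∈ trigPoly.topologicalClosure :=
  mem_closure_of_eq_comp_norm hf continuous_id (modulus_apply f)

theorem intervalMean_modulus (f : ℝ →ᵇ ℂ) (T : ℝ) :
    intervalMean T (modulus f) = ((1 / (2 * T) * ∫ t in (-T)..T, ‖f t‖ : ℝ) : ℂ) := by
  rw [intervalMean_apply]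
  simp only [modulus_apply, intervalIntegral.integral_ofReal]
  push_cast
  rfl

/-- The mean value of the modulus, as a real number. -/
noncomputable def meanModulus (f : ℝ →ᵇ ℂ) : ℝ := (meanValue (modulus f)).re

theorem tendsto_integral_norm {f : ℝ →ᵇ ℂ} (hf : f ∈ trigPoly) :
    Tendsto (fun T : ℝ => 1 / (2 * T) * ∫ t in (-T)..T, ‖f t‖) atTop (𝓝 (meanModulus f)) := by
  have h := (Complex.continuous_re.tendsto _).comp
    (isAveraging_intervalMean.tendsto_meanValue (modulus_mem hf))
  refine h.congr fun T => ?_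
  rw [Function.comp_apply, intervalMean_modulus, Complex.ofReal_re]

theorem meanValue_modulus {f : ℝ →ᵇ ℂ} (hf : f ∈ trigPoly) :
    meanValue (modulus f) = meanModulus f := by
  refine tendsto_nhds_unique (isAveraging_intervalMean.tendsto_meanValue (modulus_mem hf)) ?_
  simp only [intervalMean_modulus]
  exact (Complex.continuous_ofReal.tendsto _).comp (tendsto_integral_norm hf)

theorem meanModulus_nonneg {f : ℝ →ᵇ ℂ} (hf : f ∈ trigPoly) : 0 ≤ meanModulus f := by
  refine ge_of_tendsto (tendsto_integral_norm hf) ?_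
  filter_upwards [eventually_gt_atTop 0] with T hT
  have := intervalIntegral.integral_nonneg (a := -T) (b := T) (by linarith)
    (f := fun t => ‖f t‖) (μ := MeasureTheory.volume) fun t _ => norm_nonneg _
  positivity

theorem sampleMean_modulus (f : ℝ →ᵇ ℂ) (s : ℝ) (n : ℕ) :
    sampleMean s n (modulus f)
      = ((((n : ℝ) ^ 2)⁻¹ * ∑ j ∈ Finset.range (n ^ 2), ‖f (s - j / n)‖ : ℝ) : ℂ) := by
  rw [sampleMean_apply]
  simp [modulus_apply]

theorem tendsto_sampleMean_norm {f : ℝ →ᵇ ℂ} (hf : f ∈ trigPoly) (s : ℝ) :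
    Tendsto (fun n : ℕ => ((n : ℝ) ^ 2)⁻¹ * ∑ j ∈ Finset.range (n ^ 2), ‖f (s - j / n)‖) atTop
      (𝓝 (meanModulus f)) := by
  have h := (Complex.continuous_re.tendsto _).comp
    ((isAveraging_sampleMean s).tendsto_meanValue (modulus_mem hf))
  refine h.congr fun n => ?_
  rw [Function.comp_apply, sampleMean_modulus, Complex.ofReal_re]

section

variable {ω : ℕ → ℝ} {J : Finset ℕ}

theorem dirichletKernel_apply (t : ℝ) :
    dirichletKernel ω J t = ∑ n ∈ J, expChar (-ω n) t := by
  rw [dirichletKernel, BoundedContinuousFunction.coe_sum, Finset.sum_apply]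

theorem dirichletKernel_mem : dirichletKernel ω J ∈ trigPoly :=
  sum_mem fun n _ => expChar_mem_trigPoly (-ω n)

theorem meanValue_sum_smul_expChar (a : ℕ → ℂ) (μ : ℝ) :
    meanValue (∑ n ∈ J, a n • expChar (μ + ω n)) = ∑ n ∈ J, a n * if μ + ω n = 0 then 1 else 0 := by
  rw [meanValue_sum _ fun n _ => mem_closure_of_mem_trigPoly
    (Submodule.smul_mem _ _ (expChar_mem_trigPoly _))]
  refine Finset.sum_congr rfl fun n _ => ?_
  rw [meanValue_smul _ (mem_closure_of_mem_trigPoly (expChar_mem_trigPoly _)), meanValue_expChar]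

theorem expChar_mul_star_dirichletKernel (μ : ℝ) :
    expChar μ * star (dirichletKernel ω J) = ∑ n ∈ J, (1 : ℕ → ℂ) n • expChar (μ + ω n) := by
  simp [dirichletKernel, star_sum, star_expChar, Finset.mul_sum, expChar_mul]

/-! ### Dirichlet polynomials on the imaginary line -/

namespace HInfty

/-- The Dirichlet polynomial with a given sequence of coefficients. -/
noncomputable def ofCoeff (a : ℕ → ℂ) : HInfty ω J :=
  ⟨fun s => ∑ n ∈ J, a n * Complex.exp (-(ω n : ℂ) * s), a, rfl⟩

theorem ofCoeff_surjective (D : HInfty ω J) : ∃ a : ℕ → ℂ, ofCoeff a = D := by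
  obtain ⟨a, ha⟩ := D.exists_coeff
  exact ⟨a, Subtype.ext ha.symm⟩

theorem restrict_ofCoeff (a : ℕ → ℂ) :
    restrict (ofCoeff a : HInfty ω J) = ∑ n ∈ J, a n • expChar (-ω n) := by
  ext t
  rw [BoundedContinuousFunction.coe_sum, Finset.sum_apply, restrict_apply]
  refine Finset.sum_congr rfl fun n _ => ?_
  rw [BoundedContinuousFunction.smul_apply, smul_eq_mul, expChar_apply]
  push_cast
  ring_nf

/-- Restriction to the imaginary line, as an isometric embedding. -/
noncomputable def restrictIsometry : HInfty ω J →ₗᵢ[ℂ] (ℝ →ᵇ ℂ) where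
  toLinearMap := restrict
  norm_map' _ := rfl

theorem restrictIsometry_apply (D : HInfty ω J) : restrictIsometry D = restrict D := rfl

instance : FiniteDimensional ℂ (HInfty ω J) := by
  classical
  let S : Submodule ℂ (ℝ →ᵇ ℂ) := Submodule.span ℂ (J.image fun n => expChar (-ω n) : Finset _)
  have hS : ∀ D : HInfty ω J, restrict D ∈ S := by
    intro D
    obtain ⟨a, rfl⟩ := D.ofCoeff_surjective
    rw [restrict_ofCoeff]
    refine sum_mem fun n hn => Submodule.smul_mem _ _ (Submodule.subset_span ?_)
    exact Finset.mem_coe.2 (Finset.mem_image_of_mem _ hn)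
  have : FiniteDimensional ℂ S := FiniteDimensional.span_finset ℂ _
  exact Module.Finite.of_injective (restrict.codRestrict S hS) fun D E h =>
    restrict_injective (congrArg Subtype.val h)

/-- The translate by `t` of the Dirichlet kernel, as a Dirichlet polynomial. -/
noncomputable def translatedKernel (ω : ℕ → ℝ) (J : Finset ℕ) (t : ℝ) : HInfty ω J :=
  ofCoeff fun n => expChar (ω n) t

theorem restrict_translatedKernel (s t : ℝ) :
    restrict (translatedKernel ω J t) s = dirichletKernel ω J (s - t) := by
  rw [translatedKernel, restrict_ofCoeff, dirichletKernel_apply,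
    BoundedContinuousFunction.coe_sum, Finset.sum_apply]
  refine Finset.sum_congr rfl fun n _ => ?_
  rw [BoundedContinuousFunction.smul_apply, smul_eq_mul, sub_eq_neg_add, expChar_apply_add,
    expChar_apply_neg, neg_neg]

/-- The kernel reproduces Dirichlet polynomials under discrete averages. -/
theorem tendsto_sampleMean_reproducing (hω : Function.Injective ω) (D : HInfty ω J) (s : ℝ) :
    Tendsto (fun n : ℕ => ((n : ℂ) ^ 2)⁻¹ * ∑ j ∈ Finset.range (n ^ 2),
      restrict D (j / n) * dirichletKernel ω J (s - j / n)) atTop (𝓝 (restrict D s)) := by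
  obtain ⟨a, rfl⟩ := D.ofCoeff_surjective
  -- `F t = D (s - t) * K t`, where `K` is the kernel
  set F : ℝ →ᵇ ℂ :=
    ∑ m ∈ J, (a m * expChar (-ω m) s) • (expChar (ω m) * dirichletKernel ω J) with hF
  have hmem : ∀ m, expChar (ω m) * dirichletKernel ω J ∈ trigPoly := fun m =>
    mul_mem_trigPoly (expChar_mem_trigPoly _) dirichletKernel_mem
  have hFmem : F ∈ trigPoly := sum_mem fun m _ => Submodule.smul_mem _ _ (hmem m)
  have hmean : ∀ m ∈ J, meanValue (expChar (ω m) * dirichletKernel ω J) = 1 := by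
    intro m hm
    rw [dirichletKernel, Finset.mul_sum, meanValue_sum]
    · simp_rw [expChar_mul, meanValue_expChar]
      rw [Finset.sum_eq_single m]
      · simp
      · intro n _ hn
        rw [if_neg]
        intro h
        exact hn (hω (by linarith))
      · exact fun h => absurd hm h
    · exact fun n _ => mem_closure_of_mem_trigPoly
        (mul_mem_trigPoly (expChar_mem_trigPoly _) (expChar_mem_trigPoly _))
  have hval : meanValue F = restrict (ofCoeff a : HInfty ω J) s := by
    rw [hF, meanValue_sum _ fun m _ => mem_closure_of_mem_trigPoly
      (Submodule.smul_mem _ _ (hmem m)), restrict_ofCoeff, BoundedContinuousFunction.coe_sum,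
      Finset.sum_apply]
    refine Finset.sum_congr rfl fun m hm => ?_
    rw [meanValue_smul _ (mem_closure_of_mem_trigPoly (hmem m)), hmean m hm, mul_one]
    rfl
  rw [← hval]
  refine ((isAveraging_sampleMean s).tendsto_meanValue
    (mem_closure_of_mem_trigPoly hFmem)).congr fun n => ?_
  rw [sampleMean_apply]
  congr 1
  refine Finset.sum_congr rfl fun j _ => ?_
  rw [hF, restrict_ofCoeff, BoundedContinuousFunction.coe_sum, BoundedContinuousFunction.coe_sum,
    Finset.sum_apply, Finset.sum_apply, Finset.sum_mul]
  refine Finset.sum_congr rfl fun m _ => ?_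
  have hchar : expChar (-ω m) s * expChar (ω m) (s - j / n) = expChar (-ω m) (j / n) := by
    rw [sub_eq_add_neg, expChar_apply_add, expChar_apply_neg, ← mul_assoc,
      ← BoundedContinuousFunction.mul_apply, expChar_mul, neg_add_cancel, expChar_zero,
      BoundedContinuousFunction.coe_one, Pi.one_apply, one_mul]
  rw [BoundedContinuousFunction.smul_apply, BoundedContinuousFunction.smul_apply,
    BoundedContinuousFunction.mul_apply, smul_eq_mul, smul_eq_mul, ← hchar]
  ring

/-! ### Projections of small norm -/

/-- Hahn-Banach extensions of the point evaluations of an isometric copy. -/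
theorem exists_extension_eval {Y : Type v} [NormedAddCommGroup Y] [NormedSpace ℂ Y]
    (I : HInfty ω J →ₗᵢ[ℂ] Y) (t : ℝ) :
    ∃ φ : Y →L[ℂ] ℂ, (∀ D, φ (I D) = restrict D t) ∧ ‖φ‖ ≤ 1 := by
  let p : Submodule ℂ Y := LinearMap.range I.toLinearMap
  let ψ : p →ₗ[ℂ] ℂ := (BoundedContinuousFunction.evalCLM ℂ t).toLinearMap ∘ₗ
    (restrict : HInfty ω J →ₗ[ℂ] _) ∘ₗ I.equivRange.symm.toLinearEquiv.toLinearMap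
  have hψ : ∀ x, ‖ψ x‖ ≤ 1 * ‖x‖ := fun x => by
    rw [one_mul, ← I.equivRange.symm.norm_map x]
    exact (restrict (I.equivRange.symm x)).norm_coe_le_norm t
  obtain ⟨φ, hφ, hnorm⟩ := exists_extension_norm_eq p (ψ.mkContinuous 1 hψ)
  refine ⟨φ, fun D => ?_, hnorm ▸ LinearMap.mkContinuous_norm_le _ zero_le_one _⟩
  have h := hφ (I.equivRange D)
  rw [LinearMap.mkContinuous_apply] at h
  change φ (I D) = restrict (I.equivRange.symm (I.equivRange D)) t at h
  rwa [LinearIsometryEquiv.symm_apply_apply] at h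

/-- Every isometric copy of the space of Dirichlet polynomials is the range of a projection whose
norm is at most the mean modulus of the kernel. The projection is a limit, along an ultrafilter, of
discretized convolutions with the kernel; discretizing avoids any measurable choice of the
Hahn-Banach extensions. -/
theorem exists_leftInverse_norm_le (hω : Function.Injective ω) {Y : Type v}
    [NormedAddCommGroup Y] [NormedSpace ℂ Y] (I : HInfty ω J →ₗᵢ[ℂ] Y) :
    ∃ P : Y →L[ℂ] HInfty ω J,
      (∀ D, P (I D) = D) ∧ ‖P‖ ≤ meanModulus (dirichletKernel ω J) := by
  choose φ hφ hφn using exists_extension_eval I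
  let K := dirichletKernel ω J
  have hK : K ∈ trigPoly := dirichletKernel_mem
  let T : ℕ → Y →ₗ[ℂ] HInfty ω J := fun n => ((n : ℂ) ^ 2)⁻¹ •
    ∑ j ∈ Finset.range (n ^ 2),
      (φ (j / n)).toLinearMap.smulRight (translatedKernel ω J (j / n))
  have hT : ∀ n y s, restrict (T n y) s = ((n : ℂ) ^ 2)⁻¹ *
      ∑ j ∈ Finset.range (n ^ 2), φ (j / n) y * K (s - j / n) := by
    intro n y s
    simp only [T, LinearMap.smul_apply, LinearMap.sum_apply, LinearMap.smulRight_apply, map_smul,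
      map_sum, BoundedContinuousFunction.smul_apply, BoundedContinuousFunction.coe_sum,
      Finset.sum_apply, restrict_translatedKernel, smul_eq_mul]
    rfl
  have hTs : ∀ n y s, ‖restrict (T n y) s‖ ≤
      (((n : ℝ) ^ 2)⁻¹ * ∑ j ∈ Finset.range (n ^ 2), ‖K (s - j / n)‖) * ‖y‖ := by
    intro n y s
    have hn : ‖((n : ℂ) ^ 2)⁻¹‖ = ((n : ℝ) ^ 2)⁻¹ := by simp
    rw [hT, norm_mul, hn, mul_assoc, Finset.sum_mul]
    gcongr
    refine norm_sum_le_of_le _ fun j _ => ?_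
    rw [norm_mul, mul_comm]
    gcongr
    exact ((φ (j / n)).le_of_opNorm_le (hφn _) y).trans_eq (one_mul _)
  have hTb : ∀ n y, ‖T n y‖ ≤ ‖modulus K‖ * ‖y‖ := by
    intro n y
    rw [← restrictIsometry.norm_map (T n y), restrictIsometry_apply,
      BoundedContinuousFunction.norm_le (by positivity)]
    intro s
    refine (hTs n y s).trans ?_
    gcongr
    refine le_trans ?_ (norm_sampleMean_le s n (modulus K))
    rw [sampleMean_modulus, Complex.norm_real]
    exact le_abs_self _
  have : ProperSpace (HInfty ω J) := FiniteDimensional.proper ℂ _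
  let U : Ultrafilter ℕ := Filter.hyperfilter ℕ
  have hU : (U : Filter ℕ) ≤ atTop := Nat.hyperfilter_le_atTop
  have hlim : ∀ y, ∃ D, Tendsto (fun n => T n y) U (𝓝 D) := by
    intro y
    obtain ⟨D, -, hD⟩ := (isCompact_closedBall (0 : HInfty ω J)
      (‖modulus K‖ * ‖y‖)).ultrafilter_le_nhds' (U.map fun n => T n y)
      (by
        rw [Ultrafilter.mem_map]
        exact Filter.univ_mem' fun n => by simpa using hTb n y)
    exact ⟨D, hD⟩
  choose P hP using hlim
  have hPs : ∀ y s, Tendsto (fun n => restrict (T n y) s) U (𝓝 (restrict (P y) s)) := by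
    intro y s
    have hc : Continuous fun D : HInfty ω J => restrict D s :=
      (BoundedContinuousFunction.evalCLM ℂ s).continuous.comp
        (restrictIsometry (ω := ω) (J := J)).continuous
    exact (hc.tendsto _).comp (hP y)
  have hPb : ∀ y, ‖P y‖ ≤ meanModulus K * ‖y‖ := by
    intro y
    rw [← restrictIsometry.norm_map (P y), restrictIsometry_apply,
      BoundedContinuousFunction.norm_le (mul_nonneg (meanModulus_nonneg hK) (norm_nonneg _))]
    intro s
    exact le_of_tendsto_of_tendsto (hPs y s).norm
      (((tendsto_sampleMean_norm hK s).mono_left hU).mul_const _)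
      (Eventually.of_forall fun n => hTs n y s)
  refine ⟨(linearMapOfTendsto P T (tendsto_pi_nhds.2 hP)).mkContinuous _ hPb, fun D => ?_,
    LinearMap.mkContinuous_norm_le _ (meanModulus_nonneg hK) _⟩
  change P (I D) = D
  refine restrict_injective (BoundedContinuousFunction.ext fun s => ?_)
  refine tendsto_nhds_unique (hPs (I D) s) ?_
  simp only [hT, hφ]
  exact (tendsto_sampleMean_reproducing hω D s).mono_left hU

/-! ### Projections in the space of bounded continuous functions -/

/-- Averaging the conjugates of a projection `Q` by translations gives convolution with the kernel.
Here `h s` is the value at `0` of the conjugate by the translation by `s`, applied to `f`. -/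
theorem exists_meanValue_eq (hω : Function.Injective ω) (Q : (ℝ →ᵇ ℂ) →ₗ[ℂ] (ℝ →ᵇ ℂ))
    (hQ : ∀ f, ∃ D : HInfty ω J, Q f = restrict D)
    (hid : ∀ D : HInfty ω J, Q (restrict D) = restrict D) {f : ℝ →ᵇ ℂ} (hf : f ∈ trigPoly) :
    ∃ h ∈ trigPoly, (∀ s, h s = Q (translate s f) (-s)) ∧
      meanValue h = meanValue (f * star (dirichletKernel ω J)) := by
  have hstar : star (dirichletKernel ω J) ∈ trigPoly := star_mem_trigPoly dirichletKernel_mem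
  refine Submodule.span_induction ?_ ?_ ?_ ?_ hf
  · rintro _ ⟨μ, rfl⟩
    obtain ⟨a, ha, hsum⟩ : ∃ a : ℕ → ℂ, Q (expChar μ) = restrict (ofCoeff a : HInfty ω J) ∧
        ∑ n ∈ J, a n * (if μ + ω n = 0 then 1 else 0)
          = ∑ n ∈ J, (1 : ℕ → ℂ) n * if μ + ω n = 0 then 1 else 0 := by
      by_cases h : ∃ m ∈ J, μ + ω m = 0
      · obtain ⟨m, hm, hμ⟩ := h
        have heq : expChar μ = restrict (ofCoeff (Pi.single m 1) : HInfty ω J) := by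
          rw [restrict_ofCoeff, Finset.sum_eq_single m]
          · rw [Pi.single_eq_same, one_smul, eq_neg_of_add_eq_zero_left hμ]
          · intro n _ hn
            rw [Pi.single_eq_of_ne hn, zero_smul]
          · exact fun h => absurd hm h
        refine ⟨Pi.single m 1, ?_, Finset.sum_congr rfl fun n _ => ?_⟩
        · rw [heq, hid]
        · by_cases hn : n = m
          · subst hn
            simp
          · rw [if_neg fun h => hn (hω (by linarith)), mul_zero, mul_zero]
      · obtain ⟨D, hD⟩ := hQ (expChar μ)
        obtain ⟨a, rfl⟩ := D.ofCoeff_surjective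
        refine ⟨a, hD, Finset.sum_congr rfl fun n hn => ?_⟩
        rw [if_neg fun hz => h ⟨n, hn, hz⟩, mul_zero, mul_zero]
    refine ⟨∑ n ∈ J, a n • expChar (μ + ω n),
      sum_mem fun n _ => Submodule.smul_mem _ _ (expChar_mem_trigPoly _), fun s => ?_, ?_⟩
    · rw [translate_expChar, map_smul, ha, restrict_ofCoeff,
        BoundedContinuousFunction.smul_apply, BoundedContinuousFunction.coe_sum,
        BoundedContinuousFunction.coe_sum, Finset.sum_apply, Finset.sum_apply, Finset.smul_sum]
      refine Finset.sum_congr rfl fun n _ => ?_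
      rw [BoundedContinuousFunction.smul_apply, BoundedContinuousFunction.smul_apply,
        expChar_apply_neg, neg_neg, ← expChar_mul, BoundedContinuousFunction.mul_apply]
      simp only [smul_eq_mul]
      ring
    · rw [meanValue_sum_smul_expChar, hsum, expChar_mul_star_dirichletKernel,
        meanValue_sum_smul_expChar]
  · refine ⟨0, zero_mem _, fun s => ?_, by rw [zero_mul]⟩
    have : translate s 0 = 0 := rfl
    rw [this, map_zero]
    rfl
  · rintro f g hf hg ⟨h, hh, hs, hm⟩ ⟨k, hk, ks, km⟩
    refine ⟨h + k, add_mem hh hk, fun s => ?_, ?_⟩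
    · have : translate s (f + g) = translate s f + translate s g := rfl
      rw [this, map_add, BoundedContinuousFunction.add_apply,
        BoundedContinuousFunction.add_apply, hs, ks]
    · rw [meanValue_add (mem_closure_of_mem_trigPoly hh) (mem_closure_of_mem_trigPoly hk), hm, km,
        add_mul, meanValue_add (mem_closure_of_mem_trigPoly (mul_mem_trigPoly hf hstar))
          (mem_closure_of_mem_trigPoly (mul_mem_trigPoly hg hstar))]
  · rintro c f hf ⟨h, hh, hs, hm⟩
    refine ⟨c • h, Submodule.smul_mem _ _ hh, fun s => ?_, ?_⟩
    · have : translate s (c • f) = c • translate s f := rfl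
      rw [this, map_smul, BoundedContinuousFunction.smul_apply,
        BoundedContinuousFunction.smul_apply, hs]
    · rw [meanValue_smul _ (mem_closure_of_mem_trigPoly hh), hm, smul_mul_assoc,
        meanValue_smul _ (mem_closure_of_mem_trigPoly (mul_mem_trigPoly hf hstar))]

theorem norm_meanValue_mul_star_le (hω : Function.Injective ω)
    (Q : (ℝ →ᵇ ℂ) →ₗ[ℂ] (ℝ →ᵇ ℂ)) (hQ : ∀ f, ∃ D : HInfty ω J, Q f = restrict D)
    (hid : ∀ D : HInfty ω J, Q (restrict D) = restrict D) {C : ℝ} (hC : 0 ≤ C)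
    (hle : ∀ f, ‖Q f‖ ≤ C * ‖f‖) {f : ℝ →ᵇ ℂ} (hf : f ∈ trigPoly.topologicalClosure) :
    ‖meanValue (f * star (dirichletKernel ω J))‖ ≤ C * ‖f‖ := by
  have hstar : star (dirichletKernel ω J) ∈ trigPoly := star_mem_trigPoly dirichletKernel_mem
  have hpoly : ∀ f ∈ trigPoly,
      ‖meanValue (f * star (dirichletKernel ω J))‖ ≤ C * ‖f‖ := by
    intro f hf
    obtain ⟨h, hh, hs, hm⟩ := exists_meanValue_eq hω Q hQ hid hf
    rw [← hm]
    refine (norm_meanValue_le (mem_closure_of_mem_trigPoly hh)).trans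
      ((BoundedContinuousFunction.norm_le (by positivity)).2 fun s => ?_)
    rw [hs]
    refine ((Q (translate s f)).norm_coe_le_norm _).trans ((hle _).trans ?_)
    gcongr
    exact norm_translate_le s f
  have hf' := hf
  rw [← SetLike.mem_coe, Submodule.topologicalClosure_coe, mem_closure_iff_seq_limit] at hf'
  obtain ⟨F, hF, hlim⟩ := hf'
  have hmul : ∀ g ∈ trigPoly.topologicalClosure,
      g * star (dirichletKernel ω J) ∈ trigPoly.topologicalClosure := fun g hg => by
    rw [mul_comm]
    exact mul_mem_closure_trigPoly hstar hg
  have hconv : Tendsto (fun k => meanValue (F k * star (dirichletKernel ω J))) atTop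
      (𝓝 (meanValue (f * star (dirichletKernel ω J)))) := by
    rw [tendsto_iff_norm_sub_tendsto_zero]
    have h0 := (tendsto_iff_norm_sub_tendsto_zero.1
      (hlim.mul_const (star (dirichletKernel ω J))))
    refine squeeze_zero (fun _ => norm_nonneg _) (fun k => ?_) h0
    have hk := hmul _ (mem_closure_of_mem_trigPoly (hF k))
    rw [← meanValue_sub hk (hmul f hf)]
    exact norm_meanValue_le (sub_mem hk (hmul f hf))
  exact le_of_tendsto_of_tendsto' hconv.norm (hlim.norm.const_mul C) fun k => hpoly _ (hF k)

/-- The norm of a projection of the bounded continuous functions onto the Dirichlet polynomials is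
at least the mean modulus of the kernel. The functions tested are regularizations
`K / max ‖K‖ δ` of the sign of the kernel `K`. -/
theorem meanModulus_le_of_projection (hω : Function.Injective ω)
    (Q : (ℝ →ᵇ ℂ) →ₗ[ℂ] (ℝ →ᵇ ℂ)) (hQ : ∀ f, ∃ D : HInfty ω J, Q f = restrict D)
    (hid : ∀ D : HInfty ω J, Q (restrict D) = restrict D) {C : ℝ} (hC : 0 ≤ C)
    (hle : ∀ f, ‖Q f‖ ≤ C * ‖f‖) : meanModulus (dirichletKernel ω J) ≤ C := by
  set K := dirichletKernel ω J with hKdef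
  have hK : K ∈ trigPoly := dirichletKernel_mem
  refine le_of_forall_pos_le_add fun δ hδ => ?_
  have hmax : ∀ x : ℝ, 0 < max x δ := fun x => lt_max_of_lt_right hδ
  have hgc : Continuous fun x : ℝ => (max x δ)⁻¹ :=
    (continuous_id.max continuous_const).inv₀ fun x => (hmax x).ne'
  let G : ℝ →ᵇ ℂ := BoundedContinuousFunction.ofNormedAddCommGroup
    (fun t => (((max ‖K t‖ δ)⁻¹ : ℝ) : ℂ))
    (Complex.continuous_ofReal.comp (hgc.comp K.continuous.norm)) δ⁻¹ fun t => by
      rw [Complex.norm_real, Real.norm_eq_abs, abs_of_pos (inv_pos.2 (hmax _))]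
      gcongr
      exact le_max_right _ _
  have hG : ∀ t, G t = (((max ‖K t‖ δ)⁻¹ : ℝ) : ℂ) := fun t => rfl
  have hGmem : G ∈ trigPoly.topologicalClosure := mem_closure_of_eq_comp_norm hK hgc hG
  have hf : K * G ∈ trigPoly.topologicalClosure := mul_mem_closure_trigPoly hK hGmem
  have hfn : ‖K * G‖ ≤ 1 := by
    refine (BoundedContinuousFunction.norm_le zero_le_one).2 fun t => ?_
    rw [BoundedContinuousFunction.mul_apply, hG, norm_mul, Complex.norm_real, Real.norm_eq_abs,
      abs_of_pos (inv_pos.2 (hmax _)), ← div_eq_mul_inv, div_le_one (hmax _)]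
    exact le_max_left _ _
  have hfs : K * G * star K ∈ trigPoly.topologicalClosure := by
    rw [mul_comm]
    exact mul_mem_closure_trigPoly (star_mem_trigPoly hK) hf
  have hdiff : ‖modulus K - K * G * star K‖ ≤ δ := by
    refine (BoundedContinuousFunction.norm_le hδ.le).2 fun t => ?_
    have hval : (modulus K - K * G * star K) t
        = ((‖K t‖ - ‖K t‖ ^ 2 * (max ‖K t‖ δ)⁻¹ : ℝ) : ℂ) := by
      rw [BoundedContinuousFunction.sub_apply, BoundedContinuousFunction.mul_apply,
        BoundedContinuousFunction.mul_apply, BoundedContinuousFunction.star_apply, hG,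
        modulus_apply, mul_right_comm, Complex.star_def, Complex.mul_conj']
      push_cast
      rfl
    rw [hval, Complex.norm_real, Real.norm_eq_abs]
    rcases le_total δ ‖K t‖ with h | h
    · have hpos : ‖K t‖ ≠ 0 := (hδ.trans_le h).ne'
      rw [max_eq_left h, pow_two, mul_inv_cancel_right₀ hpos, sub_self, abs_zero]
      exact hδ.le
    · rw [max_eq_right h]
      have h1 : ‖K t‖ ^ 2 * δ⁻¹ ≤ ‖K t‖ := by
        rw [← div_eq_mul_inv, div_le_iff₀ hδ, pow_two]
        gcongr
      have h2 : 0 ≤ ‖K t‖ ^ 2 * δ⁻¹ := by positivity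
      rw [abs_le]
      constructor <;> linarith
  have hmain : ‖meanValue (modulus K)‖ ≤ δ + C * 1 := by
    have hsplit : meanValue (modulus K)
        = meanValue (modulus K - K * G * star K) + meanValue (K * G * star K) := by
      rw [meanValue_sub (modulus_mem hK) hfs, sub_add_cancel]
    rw [hsplit]
    refine (norm_add_le _ _).trans (add_le_add
      ((norm_meanValue_le (sub_mem (modulus_mem hK) hfs)).trans hdiff) ?_)
    refine (norm_meanValue_mul_star_le hω Q hQ hid hC hle hf).trans ?_
    gcongr
  rw [meanValue_modulus hK, Complex.norm_real, Real.norm_eq_abs] at hmain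
  linarith [le_abs_self (meanModulus K)]

/-! ### The projection constant -/

theorem relProjConst_range_le (hω : Function.Injective ω) {Y : Type v}
    [NormedAddCommGroup Y] [NormedSpace ℂ Y] (I : HInfty ω J →ₗᵢ[ℂ] Y) :
    relProjConst (LinearMap.range I.toLinearMap)
      ≤ ENNReal.ofReal (meanModulus (dirichletKernel ω J)) := by
  obtain ⟨P, hP, hnorm⟩ := exists_leftInverse_norm_le hω I
  let R : Y →L[ℂ] LinearMap.range I.toLinearMap :=
    I.equivRange.toContinuousLinearEquiv.toContinuousLinearMap.comp P
  have hR : ∀ y, R y = I.equivRange (P y) := fun y => rfl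
  refine iInf₂_le_of_le R ?_ (ENNReal.ofReal_le_ofReal ?_)
  · rintro ⟨_, D, rfl⟩
    refine Subtype.ext ?_
    change I (P (I D)) = I D
    rw [hP]
  · refine ContinuousLinearMap.opNorm_le_bound _ (meanModulus_nonneg dirichletKernel_mem)
      fun y => ?_
    rw [hR, LinearIsometryEquiv.norm_map]
    exact P.le_of_opNorm_le hnorm y

/-- Restriction to the imaginary line, with values in a copy of the bounded continuous functions in
an arbitrary universe. -/
noncomputable def uliftRestrict : HInfty ω J →ₗᵢ[ℂ] ULift.{v} (ℝ →ᵇ ℂ) :=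
  (LinearIsometryEquiv.ulift ℂ (ℝ →ᵇ ℂ)).symm.toLinearIsometry.comp restrictIsometry

theorem le_relProjConst_range_uliftRestrict (hω : Function.Injective ω) :
    ENNReal.ofReal (meanModulus (dirichletKernel ω J)) ≤
      relProjConst (LinearMap.range
        (uliftRestrict : HInfty ω J →ₗᵢ[ℂ] ULift.{v} (ℝ →ᵇ ℂ)).toLinearMap) := by
  refine le_iInf₂ fun P hP => ENNReal.ofReal_le_ofReal ?_
  let e : ULift.{v} (ℝ →ᵇ ℂ) ≃ₗᵢ[ℂ] (ℝ →ᵇ ℂ) := LinearIsometryEquiv.ulift ℂ (ℝ →ᵇ ℂ)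
  let Q : (ℝ →ᵇ ℂ) →ₗ[ℂ] (ℝ →ᵇ ℂ) := e.toLinearEquiv.toLinearMap ∘ₗ Submodule.subtype _ ∘ₗ
    P.toLinearMap ∘ₗ e.symm.toLinearEquiv.toLinearMap
  have hQapp : ∀ f, Q f = (P (ULift.up f) : ULift.{v} (ℝ →ᵇ ℂ)).down := fun f => rfl
  refine meanModulus_le_of_projection hω Q (fun f => ?_) (fun D => ?_) (norm_nonneg P) fun f => ?_
  · obtain ⟨D, hD⟩ := (P (ULift.up f)).2
    exact ⟨D, (hQapp f).trans (congrArg ULift.down hD.symm)⟩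
  · rw [hQapp]
    exact congrArg (fun x => ULift.down x.1) (hP ⟨ULift.up (restrict D), D, rfl⟩)
  · rw [hQapp, ULift.norm_down]
    exact P.le_opNorm (ULift.up f)

theorem projConst_eq (hω : Function.Injective ω) :
    projConst.{0, v} (HInfty ω J) = ENNReal.ofReal (meanModulus (dirichletKernel ω J)) := by
  refine le_antisymm ?_ ?_
  · exact iSup_le fun Y => iSup_le fun _ => iSup_le fun _ => iSup_le fun _ => iSup_le fun I =>
      iSup_le fun _ => relProjConst_range_le hω I
  · refine (le_relProjConst_range_uliftRestrict.{v} hω).trans ?_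
    exact le_iSup_of_le (ULift.{v} (ℝ →ᵇ ℂ)) <| le_iSup_of_le inferInstance <|
      le_iSup_of_le inferInstance <| le_iSup_of_le inferInstance <|
      le_iSup_of_le uliftRestrict <|
      le_iSup_of_le (Submodule.ClosedComplemented.of_finiteDimensional _) le_rfl

end HInfty

end

end DirichletProj

theorem theorem2p1 (ω : ℕ → ℝ) (hω : DirichletProj.IsFrequency ω) (J : Finset ℕ) :
    DirichletProj.projConst.{0, v} (DirichletProj.HInfty ω J) ≠ ∞ ∧
    Tendsto
      (fun T : ℝ => 1 / (2 * T) *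
        ∫ t in (-T)..T, ‖∑ n ∈ J, Complex.exp (-(Complex.I * (ω n : ℂ) * (t : ℂ)))‖)
      atTop
      (𝓝 (DirichletProj.projConst.{0, v} (DirichletProj.HInfty ω J)).toReal) := by
  rw [DirichletProj.HInfty.projConst_eq hω.strictMono.injective]
  refine ⟨ENNReal.ofReal_ne_top, ?_⟩
  have hK : DirichletProj.dirichletKernel ω J ∈ DirichletProj.trigPoly :=
    DirichletProj.dirichletKernel_mem
  rw [ENNReal.toReal_ofReal (DirichletProj.meanModulus_nonneg hK)]
  refine (DirichletProj.tendsto_integral_norm hK).congr fun T => ?_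
  simp [DirichletProj.dirichletKernel_apply, DirichletProj.expChar_apply]
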